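/- Fix an integer $r\ge 2$. An $r$-graph is a finite hypergraph all of whose edges have exactly $r$ vertices; $v(H)$ and $e(H)$ denote its numbers of vertices and edges, and it is nontrivial if $e(H)\ge 2$. Its chromatic number is the least number of colors in a vertex coloring without monochromatic edges. For a family $\mathcal H$ of $r$-graphs, $m_k(\mathcal H)$ is the minimum number of edges in an $r$-graph with chromatic number greater than $k$ that contains no (not necessarily induced) copy of any member of $\mathcal H$. For a nontrivial $r$-graph $H$ let $\rho(H)=\max_{H'\subseteq H}\frac{e(H')-1}{v(H')-r}$, the maximum being over the nontrivial subhypergraphs $H'$ of $H$; $H$ is balanced if $\rho(H)=\frac{e(H)-1}{v(H)-r}$. **Theorem.** Let $\mathcal H=\{H_1,\dots,H_\ell\}$, $\ell\ge 1$, be a finite family of nontrivial balanced $r$-graphs, and put $e_i=e(H_i)$, $\rho_i=\rho(H_i)$, $\rho=\min_i\rho_i$ and $I=\{i:\rho_i=\rho\}$. Assume that $\rho>1/(r-1)$. For an edge $e$ of $H_i$ let $\alpha_i(e)$ be the number of automorphisms of $H_i$ that map $e$ to itself, and let $\alpha_i=\min_{e}\alpha_i(e)$. Then there is a unique positive real number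 $c_1$ with $$\sum_{i\in I}\frac{e_i c_1^{e_i-1}}{\alpha_i}=\frac{1}{50\,r!},$$ and $$c_2:=\max_{i\in I}\left(\frac{\alpha_i}{5e_ic_1^{e_i-1}r!}\right)^{1/(r-1)}\ \ge\ 10^{1/(r-1)} .$$ Moreover, for all sufficiently large $k$, $m_k(\mathcal H)$ is well defined (there is an $\mathcal H$-free $r$-graph with chromatic number greater than $k$) and $$m_k(\mathcal H)<c_{\mathcal H}\,\bigl(k^{r-1}\log k\bigr)^{\frac{r-1/\rho}{r-1-1/\rho}},$$ where $$c_{\mathcal H}=2\left(\frac{r!}{c_1}\right)^{\frac{1}{r-1-1/\rho}}c_2^{\frac{(r-1)(r-1/\rho)}{r-1-1/\rho}}\left(\frac{r-1}{r-1-1/\rho}\right)^{\frac{r-1/\rho}{r-1-1/\rho}} .$$ The factor $2$ in $c_{\mathcal H}$ may be replaced by any constant $C>1$ (with the threshold for $k$ then depending also on $C$). -/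

import Mathlib

open Filter

noncomputable section

namespace Hypergraph

/-- Every edge has exactly `r` vertices. A finite `Hypergraph` with this property is an `r`-graph. -/
def IsUniform {α : Type*} (H : Hypergraph α) (r : ℕ) : Prop :=
  ∀ e ∈ H.edgeSet, e.encard = r

/-- `H'` is a (not necessarily induced) subhypergraph of `H`. -/
def IsSub {α : Type*} (H' H : Hypergraph α) : Prop :=
  H'.vertexSet ⊆ H.vertexSet ∧ H'.edgeSet ⊆ H.edgeSet

/-- At least two edges. -/
def Nontrivial {α : Type*} (H : Hypergraph α) : Prop := H.edgeSet.Nontrivial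

/-- The number of vertices. -/
def numVerts {α : Type*} (H : Hypergraph α) : ℕ := H.vertexSet.ncard

/-- The number of edges. -/
def numEdges {α : Type*} (H : Hypergraph α) : ℕ := H.edgeSet.ncard

/-- The ratio `(e - 1) / (v - r)`. -/
def density {α : Type*} (r : ℕ) (H : Hypergraph α) : ℝ :=
  ((H.numEdges : ℝ) - 1) / ((H.numVerts : ℝ) - r)

/-- `ρ(H)`: the maximum of `(e' - 1) / (v' - r)` over the nontrivial subhypergraphs of `H`
(for finite nontrivial `H` the supremum is over a finite nonempty set). -/
def rho {α : Type*} (r : ℕ) (H : Hypergraph α) : ℝ :=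
  sSup {x : ℝ | ∃ H' : Hypergraph α, H'.IsSub H ∧ H'.Nontrivial ∧ x = H'.density r}

/-- The maximum defining `ρ(H)` is attained by `H` itself. -/
def IsBalanced {α : Type*} (r : ℕ) (H : Hypergraph α) : Prop :=
  H.rho r = H.density r

/-- A permutation of the vertices of `H` is an automorphism if it preserves edges and non-edges. -/
def IsAut {α : Type*} (H : Hypergraph α) (σ : Equiv.Perm H.vertexSet) : Prop :=
  ∀ e : Set H.vertexSet,
    Subtype.val '' (σ '' e) ∈ H.edgeSet ↔ Subtype.val '' e ∈ H.edgeSet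

/-- The number of automorphisms of `H` that map the edge `e` to itself (as a set). -/
def stabCount {α : Type*} (H : Hypergraph α) (e : Set α) : ℕ :=
  Nat.card {σ : Equiv.Perm H.vertexSet //
    H.IsAut σ ∧ Subtype.val '' (σ '' (Subtype.val ⁻¹' e)) = e}

/-- The minimum of `stabCount H e` over the edges `e` of `H`. -/
def minStab {α : Type*} (H : Hypergraph α) : ℕ :=
  sInf (H.stabCount '' H.edgeSet)

/-- `G` contains a (not necessarily induced) copy of `F`. -/
def Contains {α β : Type*} (G : Hypergraph β) (F : Hypergraph α) : Prop :=
  ∃ f : α → β, Set.InjOn f F.vertexSet ∧ (F.image f).IsSub G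

/-- There is a vertex colouring with `k` colours and without monochromatic edges. -/
def Colorable {α : Type*} (G : Hypergraph α) (k : ℕ) : Prop :=
  ∃ c : G.vertexSet → Fin k,
    ∀ e ∈ G.edgeSet, ¬ ∃ a : Fin k, ∀ v : G.vertexSet, (v : α) ∈ e → c v = a

/-- The least number of colours in a vertex colouring without monochromatic edges. -/
def chromaticNumber {α : Type*} (G : Hypergraph α) : ℕ∞ :=
  ⨅ k ∈ {k : ℕ | G.Colorable k}, (k : ℕ∞)

/-- The numbers of edges of the finite `r`-graphs that contain no member of the family `H`
and have chromatic number greater than `k`. -/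
def edgeCounts {ι : Type*} {α : ι → Type*} (r : ℕ) (H : ∀ i, Hypergraph (α i)) (k : ℕ) :
    Set ℕ :=
  {m : ℕ | ∃ (n : ℕ) (G : Hypergraph (Fin n)), G.IsUniform r ∧ (∀ i, ¬ G.Contains (H i)) ∧
    (k : ℕ∞) < G.chromaticNumber ∧ G.numEdges = m}

/-- `m_k(H)`: the minimum number of edges in an `H`-free `r`-graph of chromatic number greater
than `k`. (It is meaningful when `edgeCounts r H k` is nonempty.) -/
def minEdges {ι : Type*} {α : ι → Type*} (r : ℕ) (H : ∀ i, Hypergraph (α i)) (k : ℕ) : ℕ :=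
  sInf (edgeCounts r H k)

/-- `ρ` of a family: the minimum of `ρ(H i)`. -/
def familyRho {ι : Type*} {α : ι → Type*} (r : ℕ) (H : ∀ i, Hypergraph (α i)) : ℝ :=
  ⨅ i, (H i).rho r

open Classical in
/-- The indices `i` with `ρ(H i)` equal to the minimum. -/
def critical {ι : Type*} [Fintype ι] {α : ι → Type*} (r : ℕ) (H : ∀ i, Hypergraph (α i)) :
    Finset ι :=
  Finset.univ.filter fun i => (H i).rho r = familyRho r H

/-- `∑ e_i x ^ (e_i - 1) / α_i` over the critical indices `i`. -/
def criticalSum {ι : Type*} [Fintype ι] {α : ι → Type*} (r : ℕ) (H : ∀ i, Hypergraph (α i))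
    (x : ℝ) : ℝ :=
  ∑ i ∈ critical r H,
    ((H i).numEdges : ℝ) * x ^ ((H i).numEdges - 1) / ((H i).minStab : ℝ)

/-- The bound `C (r!/c₁)^{1/(r-1-1/ρ)} c₂^{(r-1)(r-1/ρ)/(r-1-1/ρ)}
((r-1)/(r-1-1/ρ))^{(r-1/ρ)/(r-1-1/ρ)} (k^{r-1} log k)^{(r-1/ρ)/(r-1-1/ρ)}`. -/
def edgeBound (C : ℝ) (r : ℕ) (ρ c₁ c₂ : ℝ) (k : ℕ) : ℝ :=
  C * ((r.factorial : ℝ) / c₁) ^ (1 / ((r : ℝ) - 1 - 1 / ρ))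
    * c₂ ^ (((r : ℝ) - 1) * ((r : ℝ) - 1 / ρ) / ((r : ℝ) - 1 - 1 / ρ))
    * (((r : ℝ) - 1) / ((r : ℝ) - 1 - 1 / ρ)) ^ (((r : ℝ) - 1 / ρ) / ((r : ℝ) - 1 - 1 / ρ))
    * ((k : ℝ) ^ (r - 1) * Real.log k) ^ (((r : ℝ) - 1 / ρ) / ((r : ℝ) - 1 - 1 / ρ))

end Hypergraph

end

/-! The hypergraph comes from random deletion. Take each `r`-subset of `n` points independently with
probability `p = c₁ n^(-1/ρ)` and delete a maximal edge-disjoint family of copies of the `H i`; by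
maximality the rest is free of every `H i`. If every `s`-set still spans an edge and `k s ≤ n`, no
colouring with `k` colours is proper, since some colour class has at least `s` vertices.

An `s`-set can fail only if all random edges inside it lie in deleted copies that meet it. As these
copies are edge-disjoint, the union bound over families of copies is dominated by a product
(`sum_weight_covered_le`) and gives at most `(1-p)^N exp(N T)` with `N = s.choose r`, where `T`
bounds the weighted number of copies through one edge. Double counting bounds that number for `H i`
by `e_i r! n^(v_i-r) / α_i`, and balancedness gives `T/p → r! * criticalSum = 1/50`
(`tendsto_copies_through_edge`). Failure thus has probability at most `exp(-0.9 p N)`, which beats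
the at most `n^s` choices of the set once `p N ≥ 2 s log n`. Together with Markov's inequality for
the number of edges, `exists_free_transversal` produces the hypergraph.

Choosing `n` and `s` in terms of `k` (`eventually_exists_parameters`) turns the edge count `2 p n^r
/ r!` into the stated bound, already with leading constant `1`; the factor `2` and every `C > 1` are
then immediate. -/

namespace RandomSubset

open Finset

/-! ### Random subsets and deletion of a disjoint family -/

variable {E : Type*} [DecidableEq E]

/-- The probability that the random subset of `U` containing each element independently with
probability `p` equals `G`. -/
def weight (U : Finset E) (p : ℝ) (G : Finset E) : ℝ := p ^ #G * (1 - p) ^ #(U \ G)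

lemma weight_nonneg (U : Finset E) {p : ℝ} (hp0 : 0 ≤ p) (hp1 : p < 1) (G : Finset E) :
    0 ≤ weight U p G :=
  mul_nonneg (pow_nonneg hp0 _) (pow_nonneg (by linarith) _)

lemma sum_weight_between (U A B : Finset E) (hA : A ⊆ U) (hB : B ⊆ U) (p : ℝ) :
    ∑ G ∈ U.powerset with (A ⊆ G ∧ G ∩ B ⊆ A), weight U p G = p ^ #A * (1 - p) ^ #(B \ A) := by
  -- Zeroing the "in" factor on `B \ A` and the "out" factor on `A` kills exactly the sets `G` that
  -- violate the condition when the product is expanded.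
  have key := prod_add (fun e => if e ∈ B \ A then 0 else p)
    (fun e => if e ∈ A then 0 else 1 - p) U
  have hl : ∏ e ∈ U, ((if e ∈ B \ A then 0 else p) + (if e ∈ A then 0 else 1 - p))
      = p ^ #A * (1 - p) ^ #(B \ A) := by
    have : ∀ e ∈ U, ((if e ∈ B \ A then 0 else p) + (if e ∈ A then 0 else 1 - p))
        = (if e ∈ A then p else 1) * (if e ∈ B \ A then 1 - p else 1) := by
      intro e _
      by_cases h1 : e ∈ A <;> by_cases h2 : e ∈ B <;> simp [h1, h2]
    rw [prod_congr rfl this, prod_mul_distrib, prod_ite_mem, prod_ite_mem, prod_const,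
      prod_const, inter_eq_right.2 hA, inter_eq_right.2 (sdiff_subset.trans hB)]
  rw [hl] at key
  rw [key, sum_filter]
  refine sum_congr rfl fun G hG => ?_
  rw [mem_powerset] at hG
  split_ifs with h
  · rw [weight, ← prod_const, ← prod_const]
    congr 1
    · refine prod_congr rfl fun e he => ?_
      rw [if_neg]
      intro h'
      rw [Finset.mem_sdiff] at h'
      exact h'.2 (h.2 (mem_inter.2 ⟨he, h'.1⟩))
    · refine prod_congr rfl fun e he => ?_
      rw [if_neg]
      intro h'
      exact (Finset.mem_sdiff.1 he).2 (h.1 h')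
  · symm
    rw [not_and_or] at h
    rcases h with h | h
    · obtain ⟨e, he, heG⟩ := not_subset.1 h
      have h0 : ∏ e ∈ U \ G, (if e ∈ A then 0 else 1 - p) = 0 :=
        prod_eq_zero (Finset.mem_sdiff.2 ⟨hA he, heG⟩) (if_pos he)
      rw [h0, mul_zero]
    · obtain ⟨e, he, heA⟩ := not_subset.1 h
      rw [mem_inter] at he
      have h0 : ∏ e ∈ G, (if e ∈ B \ A then 0 else p) = 0 :=
        prod_eq_zero he.1 (if_pos (Finset.mem_sdiff.2 ⟨he.2, heA⟩))
      rw [h0, zero_mul]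

lemma sum_weight (U : Finset E) (p : ℝ) : ∑ G ∈ U.powerset, weight U p G = 1 := by
  simpa using sum_weight_between U ∅ ∅ (empty_subset _) (empty_subset _) p

lemma sum_weight_mul_card (U : Finset E) (p : ℝ) :
    ∑ G ∈ U.powerset, weight U p G * #G = p * #U := by
  have h1 : ∀ G ∈ U.powerset, weight U p G * #G = ∑ e ∈ U, if e ∈ G then weight U p G else 0 := by
    intro G hG
    rw [sum_ite_mem, sum_const, inter_eq_right.2 (mem_powerset.1 hG), nsmul_eq_mul, mul_comm]
  rw [sum_congr rfl h1, sum_comm]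
  have h2 : ∀ e ∈ U, ∑ G ∈ U.powerset, (if e ∈ G then weight U p G else 0) = p := by
    intro e he
    have := sum_weight_between U {e} ∅ (singleton_subset_iff.2 he) (empty_subset _) p
    simpa [sum_filter] using this
  rw [sum_congr rfl h2, sum_const, nsmul_eq_mul, mul_comm]

lemma sum_biUnion_le {κ : Type*} (s : Finset κ) (t : κ → Finset (Finset E))
    {f : Finset E → ℝ} (hf : ∀ x, 0 ≤ f x) :
    ∑ x ∈ s.biUnion t, f x ≤ ∑ i ∈ s, ∑ x ∈ t i, f x := by
  classical
  induction s using Finset.induction_on with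
  | empty => simp
  | insert i s hi ih =>
    rw [biUnion_insert, sum_insert hi]
    have h1 := sum_union_inter (s₁ := t i) (s₂ := s.biUnion t) (f := f)
    have h2 : 0 ≤ ∑ x ∈ t i ∩ s.biUnion t, f x := sum_nonneg fun x _ => hf x
    linarith

open Classical in
/-- The random set contains the union of some disjoint subfamily of `𝒞` that covers its trace
on `B` with probability at most `(1 - p) ^ #B * exp (∑ A ∈ 𝒞, (p / (1 - p)) ^ #A)`. -/
lemma sum_weight_covered_le (U : Finset E) (𝒞 : Finset (Finset E)) (h𝒞 : ∀ A ∈ 𝒞, A ⊆ U)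
    (B : Finset E) (hB : B ⊆ U) {p : ℝ} (hp0 : 0 ≤ p) (hp1 : p < 1) :
    ∑ G ∈ U.powerset with (∃ F ⊆ 𝒞, (F : Set (Finset E)).PairwiseDisjoint id ∧
        F.biUnion id ⊆ G ∧ G ∩ B ⊆ F.biUnion id), weight U p G
      ≤ (1 - p) ^ #B * Real.exp (∑ A ∈ 𝒞, (p / (1 - p)) ^ #A) := by
  have hp : 0 < 1 - p := by linarith
  have hq : 0 ≤ p / (1 - p) := div_nonneg hp0 hp.le
  set D := 𝒞.powerset.filter fun F : Finset (Finset E) => (F : Set (Finset E)).PairwiseDisjoint id with hD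
  calc _ ≤ ∑ G ∈ D.biUnion fun F => U.powerset.filter fun G =>
            F.biUnion id ⊆ G ∧ G ∩ B ⊆ F.biUnion id, weight U p G := by
        refine sum_le_sum_of_subset_of_nonneg ?_ fun _ _ _ => weight_nonneg U hp0 hp1 _
        intro G hG
        obtain ⟨hG, F, hF, hd, h1, h2⟩ := mem_filter.1 hG
        exact mem_biUnion.2 ⟨F, mem_filter.2 ⟨mem_powerset.2 hF, hd⟩,
          mem_filter.2 ⟨hG, h1, h2⟩⟩
    _ ≤ ∑ F ∈ D, ∑ G ∈ U.powerset with (F.biUnion id ⊆ G ∧ G ∩ B ⊆ F.biUnion id),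
          weight U p G := by
        exact sum_biUnion_le _ _ (weight_nonneg U hp0 hp1)
    _ ≤ ∑ F ∈ D, (1 - p) ^ #B * ∏ A ∈ F, (p / (1 - p)) ^ #A := by
        refine sum_le_sum fun F hF => ?_
        obtain ⟨hF, hd⟩ := mem_filter.1 hF
        rw [mem_powerset] at hF
        have hFU : F.biUnion id ⊆ U := biUnion_subset.2 fun A hA => h𝒞 A (hF hA)
        rw [sum_weight_between U _ B hFU hB, prod_pow_eq_pow_sum]
        have hc : #(F.biUnion id) = ∑ A ∈ F, #A := card_biUnion hd
        rw [← hc, div_pow]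
        set X := F.biUnion id
        -- Writing the bound in the odds `p / (1 - p)` makes it multiplicative over the members of
        -- `F`, with a factor independent of `F`.
        have h3 : (1 - p) ^ #(B \ X) * (1 - p) ^ #X ≤ (1 - p) ^ #B := by
          rw [← pow_add]
          refine pow_le_pow_of_le_one hp.le (by linarith) ?_
          have := le_card_sdiff X B
          omega
        rw [mul_div_assoc', le_div_iff₀ (pow_pos hp _)]
        calc _ = p ^ #X * ((1 - p) ^ #(B \ X) * (1 - p) ^ #X) := by ring
          _ ≤ p ^ #X * (1 - p) ^ #B := mul_le_mul_of_nonneg_left h3 (pow_nonneg hp0 _)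
          _ = _ := mul_comm _ _
    -- Disjointness has served to split the size of the union; dropping it lets the sum over all
    -- subfamilies factor as a product.
    _ ≤ ∑ F ∈ 𝒞.powerset, (1 - p) ^ #B * ∏ A ∈ F, (p / (1 - p)) ^ #A := by
        refine sum_le_sum_of_subset_of_nonneg (filter_subset _ _) fun _ _ _ => ?_
        exact mul_nonneg (pow_nonneg hp.le _) (prod_nonneg fun _ _ => pow_nonneg hq _)
    _ = (1 - p) ^ #B * ∏ A ∈ 𝒞, (1 + (p / (1 - p)) ^ #A) := by
        rw [← mul_sum, prod_one_add]
    _ ≤ _ := by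
        refine mul_le_mul_of_nonneg_left ?_ (pow_nonneg hp.le _)
        rw [Real.exp_sum]
        refine prod_le_prod (fun _ _ => add_nonneg zero_le_one (pow_nonneg hq _)) fun A _ => ?_
        rw [add_comm]
        exact Real.add_one_le_exp _

/-- Deleting a maximal disjoint subfamily of `𝒞` from `G` leaves no member of `𝒞`. -/
lemma exists_disjoint_family_deletion (𝒞 : Finset (Finset E)) (hne : ∀ A ∈ 𝒞, A.Nonempty)
    (G : Finset E) :
    ∃ F ⊆ 𝒞, (F : Set (Finset E)).PairwiseDisjoint id ∧ F.biUnion id ⊆ G ∧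
      ∀ A ∈ 𝒞, ¬ A ⊆ G \ F.biUnion id := by
  classical
  set D := 𝒞.powerset.filter fun F : Finset (Finset E) => (F : Set (Finset E)).PairwiseDisjoint id ∧ F.biUnion id ⊆ G
  have hD : D.Nonempty := ⟨∅, mem_filter.2 ⟨empty_mem_powerset _, by simp, by simp⟩⟩
  obtain ⟨F, hF, hmax⟩ := exists_max_image D card hD
  obtain ⟨hF𝒞, hd, hG⟩ := mem_filter.1 hF
  rw [mem_powerset] at hF𝒞
  refine ⟨F, hF𝒞, hd, hG, fun A hA hAG => ?_⟩
  have hdis : ∀ A' ∈ F, Disjoint A A' := fun A' hA' =>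
    disjoint_left.2 fun x hx hx' => (Finset.mem_sdiff.1 (hAG hx)).2 (mem_biUnion.2 ⟨A', hA', hx'⟩)
  -- Nonemptiness matters here: the empty set is disjoint from itself.
  have hAF : A ∉ F := fun h => by
    have := hdis A h
    rw [disjoint_self] at this
    exact (hne A hA).ne_empty this
  have hins : insert A F ∈ D := by
    refine mem_filter.2 ⟨mem_powerset.2 (insert_subset hA hF𝒞), ?_, ?_⟩
    · rw [coe_insert]
      exact hd.insert fun A' hA' _ => hdis A' hA'
    · rw [biUnion_insert]
      exact union_subset (hAG.trans sdiff_subset) hG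
  have := hmax _ hins
  rw [card_insert_of_notMem hAF] at this
  omega

/-- A set that contains no member of `𝒞`, meets every member of `ℬ` and has fewer than `m`
elements exists if the sum of the failure probabilities for a random set is less than `1`. -/
theorem exists_free_transversal (U : Finset E) (𝒞 : Finset (Finset E)) (h𝒞 : ∀ A ∈ 𝒞, A ⊆ U)
    (hne : ∀ A ∈ 𝒞, A.Nonempty) (ℬ : Finset (Finset E)) (hℬ : ∀ B ∈ ℬ, B ⊆ U)
    {p m : ℝ} (hp0 : 0 ≤ p) (hp1 : p < 1) (hm : 0 < m)
    (h : ∑ B ∈ ℬ, (1 - p) ^ #B *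
      Real.exp (∑ A ∈ 𝒞 with ¬ Disjoint A B, (p / (1 - p)) ^ #A) + p * #U / m < 1) :
    ∃ G ⊆ U, (∀ A ∈ 𝒞, ¬ A ⊆ G) ∧ (∀ B ∈ ℬ, ¬ Disjoint G B) ∧ (#G : ℝ) < m := by
  classical
  by_contra! hcon
  -- Members of the deleted family that miss `B` play no role in covering `G ∩ B`, so only those
  -- meeting `B` are charged.
  let bad : Finset E → Finset (Finset E) := fun B =>
    U.powerset.filter fun G => ∃ F ⊆ 𝒞.filter fun A => ¬ Disjoint A B,
      (F : Set (Finset E)).PairwiseDisjoint id ∧ F.biUnion id ⊆ G ∧ G ∩ B ⊆ F.biUnion id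
  have hcover : U.powerset ⊆ ℬ.biUnion bad ∪ U.powerset.filter fun G => m ≤ #G := by
    intro G hG
    have hGU := mem_powerset.1 hG
    obtain ⟨F, hF, hd, hFG, hfree⟩ := exists_disjoint_family_deletion 𝒞 hne G
    rw [mem_union, or_iff_not_imp_left]
    intro hnb
    refine mem_filter.2 ⟨hG, ?_⟩
    refine (hcon (G \ F.biUnion id) (sdiff_subset.trans hGU) hfree fun B hB hdis => ?_).trans
      (by exact_mod_cast card_le_card sdiff_subset)
    refine hnb (mem_biUnion.2 ⟨B, hB, mem_filter.2 ⟨hG, F.filter fun A => ¬ Disjoint A B,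
      filter_subset_filter _ hF, ?_, ?_, ?_⟩⟩)
    · exact hd.subset (coe_subset.2 (filter_subset _ _))
    · exact (biUnion_subset_biUnion_of_subset_left _ (filter_subset _ _)).trans hFG
    · intro x hx
      rw [mem_inter] at hx
      have hxF : x ∈ F.biUnion id := by
        by_contra hx'
        exact disjoint_left.1 hdis (Finset.mem_sdiff.2 ⟨hx.1, hx'⟩) hx.2
      obtain ⟨A, hA, hxA⟩ := mem_biUnion.1 hxF
      exact mem_biUnion.2 ⟨A, mem_filter.2 ⟨hA, fun hh => disjoint_left.1 hh hxA hx.2⟩, hxA⟩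
  have hw := weight_nonneg U hp0 hp1
  -- Markov's inequality, applied before deletion; deleting only lowers the size.
  have hlarge : ∑ G ∈ U.powerset with m ≤ #G, weight U p G ≤ p * #U / m := by
    rw [le_div_iff₀ hm, ← sum_weight_mul_card, sum_mul]
    refine (sum_le_sum fun G hG => ?_).trans
      (sum_le_sum_of_subset_of_nonneg (filter_subset _ _)
        fun G _ _ => mul_nonneg (hw G) (Nat.cast_nonneg _))
    exact mul_le_mul_of_nonneg_left (mem_filter.1 hG).2 (hw G)
  have hbad : ∑ G ∈ ℬ.biUnion bad, weight U p G ≤ ∑ B ∈ ℬ, (1 - p) ^ #B *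
      Real.exp (∑ A ∈ 𝒞 with ¬ Disjoint A B, (p / (1 - p)) ^ #A) := by
    refine (sum_biUnion_le _ _ hw).trans (sum_le_sum fun B hB => ?_)
    exact sum_weight_covered_le U _ (fun A hA => h𝒞 A (mem_filter.1 hA).1) B (hℬ B hB) hp0 hp1
  have h1 := sum_weight U p
  have h2 := sum_le_sum_of_subset_of_nonneg hcover fun G _ _ => hw G
  have h3 := sum_union_inter (s₁ := ℬ.biUnion bad)
    (s₂ := U.powerset.filter fun G => m ≤ #G) (f := weight U p)
  have h4 : 0 ≤ ∑ G ∈ ℬ.biUnion bad ∩ U.powerset.filter fun G => m ≤ #G, weight U p G :=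
    sum_nonneg fun G _ => hw G
  linarith

end RandomSubset

namespace Hypergraph

open Finset

/-! ### Counting copies through a fixed edge -/

section Copies

variable {V W : Type*} [Fintype V] [Fintype W] [DecidableEq W]

/-- The edge sets of the copies of `𝓔` in the complete hypergraph on `W`. -/
noncomputable def copies (W : Type*) [Fintype W] [DecidableEq W] (𝓔 : Finset (Finset V)) :
    Finset (Finset (Finset W)) :=
  univ.image fun f : V ↪ W => 𝓔.image fun e => e.map f

lemma card_of_mem_copies {𝓔 : Finset (Finset V)} {A : Finset (Finset W)} (hA : A ∈ copies W 𝓔) :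
    #A = #𝓔 := by
  obtain ⟨f, -, rfl⟩ := mem_image.1 hA
  exact card_image_of_injective _ (Finset.map_injective f)

/-- Such an embedding is determined by an injection of `e` into `R`, which has the same size, and by
unrestricted values off `e`. -/
lemma card_embedding_map_eq_le [DecidableEq V] (e : Finset V) (R : Finset W) :
    #{f : V ↪ W | e.map f = R} ≤ (#e).factorial * Fintype.card W ^ (Fintype.card V - #e) := by
  rcases (univ.filter fun f : V ↪ W => e.map f = R).eq_empty_or_nonempty with h | ⟨f₀, hf₀⟩
  · rw [h, card_empty]; exact Nat.zero_le _
  have hR : #R = #e := by rw [← (mem_filter.1 hf₀).2, card_map]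
  rw [← Fintype.card_subtype]
  let φ : {f : V ↪ W // e.map f = R} → (e ↪ R) × ({x // x ∉ e} → W) := fun f =>
    (⟨fun x => ⟨f.1 x, by
      have := mem_map_of_mem f.1 x.2
      rwa [f.2] at this⟩,
      fun x y hxy => Subtype.ext (f.1.injective (congrArg Subtype.val hxy))⟩, fun x => f.1 x)
  have hφ : Function.Injective φ := by
    intro f g hfg
    ext x
    by_cases hx : x ∈ e
    · have := DFunLike.congr_fun (congrArg Prod.fst hfg) ⟨x, hx⟩
      exact congrArg Subtype.val this
    · exact congrFun (congrArg Prod.snd hfg) ⟨x, hx⟩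
  refine (Fintype.card_le_of_injective φ hφ).trans_eq ?_
  rw [Fintype.card_prod, Fintype.card_embedding_eq, Fintype.card_fun, Fintype.card_coe,
    Fintype.card_coe, hR, Nat.descFactorial_self, Fintype.card_subtype_compl, Fintype.card_coe]

/-- Double count the pairs `(e, f)` with `f` sending `e` to `R`. A copy through `R` arises from at
least `a` of them: fix one pair and precompose `f` with the elements of `T e`, which preserve both
`e` and `𝓔`. -/
lemma card_copies_mem_mul_le [DecidableEq V] {r a : ℕ} (𝓔 : Finset (Finset V)) (h𝓔 : ∀ e ∈ 𝓔, #e = r)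
    (T : Finset V → Finset (Equiv.Perm V)) (hT : ∀ e ∈ 𝓔, a ≤ #(T e))
    (hT₁ : ∀ e ∈ 𝓔, ∀ σ ∈ T e, e.map σ.toEmbedding = e)
    (hT₂ : ∀ e ∈ 𝓔, ∀ σ ∈ T e, (𝓔.image fun e => e.map σ.toEmbedding) = 𝓔) (R : Finset W) :
    #{A ∈ copies W 𝓔 | R ∈ A} * a ≤
      #𝓔 * (r.factorial * Fintype.card W ^ (Fintype.card V - r)) := by
  set P : Finset (Finset V × (V ↪ W)) := (𝓔 ×ˢ univ).filter fun x => x.1.map x.2 = R with hP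
  have hPc : #P ≤ #𝓔 * (r.factorial * Fintype.card W ^ (Fintype.card V - r)) := by
    have : P = 𝓔.biUnion fun e =>
        (univ.filter fun f : V ↪ W => e.map f = R).map (Function.Embedding.sectR e _) := by
      ext ⟨e, f⟩
      simp only [hP, mem_filter, mem_product, mem_univ, and_true, mem_biUnion, Finset.mem_map,
        Function.Embedding.sectR_apply, Prod.mk.injEq, true_and]
      constructor
      · rintro ⟨h1, h2⟩
        exact ⟨e, h1, f, h2, rfl, rfl⟩
      · rintro ⟨e, h1, f, h2, rfl, rfl⟩
        exact ⟨h1, h2⟩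
    rw [this]
    refine card_biUnion_le_card_mul _ _ _ fun e he => ?_
    rw [card_map, ← h𝓔 e he]
    exact card_embedding_map_eq_le e R
  refine le_trans ?_ hPc
  rw [mul_comm]
  refine mul_card_image_le_card_of_maps_to (f := fun x => 𝓔.image fun e => e.map x.2) ?_ a ?_
  · rintro ⟨e, f⟩ hx
    obtain ⟨h1, h2⟩ := mem_filter.1 hx
    exact mem_filter.2 ⟨mem_image_of_mem _ (mem_univ f),
      mem_image.2 ⟨e, (mem_product.1 h1).1, h2⟩⟩
  · intro A hA
    obtain ⟨h1, h2⟩ := mem_filter.1 hA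
    obtain ⟨f, -, rfl⟩ := mem_image.1 h1
    obtain ⟨e, he, heR⟩ := mem_image.1 h2
    refine (hT e he).trans ?_
    refine card_le_card_of_injOn (fun σ => (e, σ.toEmbedding.trans f)) ?_ ?_
    · intro σ hσ
      refine mem_coe.2 (mem_filter.2 ⟨mem_filter.2 ⟨mem_product.2 ⟨he, mem_univ _⟩, ?_⟩, ?_⟩)
      · rw [← Finset.map_map, hT₁ e he σ hσ, heR]
      · conv_rhs => rw [← hT₂ e he σ hσ, Finset.image_image]
        refine image_congr fun e' _ => ?_
        simp [Finset.map_map]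
    · intro σ _ τ _ h
      have h' := (Prod.mk.inj h).2
      ext x
      exact f.injective (DFunLike.congr_fun h' x)

end Copies

/-! ### Finite edge sets and edge stabilizers -/

section EdgeFinset

variable {α : Type*} (H : Hypergraph α) [Fintype H.vertexSet]

open Classical in
/-- The edges as finite sets of vertices. -/
noncomputable def edgeFinset : Finset (Finset H.vertexSet) :=
  univ.filter fun e => Subtype.val '' (e : Set H.vertexSet) ∈ H.edgeSet

variable {H}

lemma mem_edgeFinset {e : Finset H.vertexSet} :
    e ∈ H.edgeFinset ↔ Subtype.val '' (e : Set H.vertexSet) ∈ H.edgeSet := by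
  simp [edgeFinset]

lemma exists_edgeFinset_of_mem {e : Set α} (he : e ∈ H.edgeSet) :
    ∃ e' ∈ H.edgeFinset, Subtype.val '' (e' : Set H.vertexSet) = e := by
  classical
  have h : Subtype.val '' (((Subtype.val ⁻¹' e : Set H.vertexSet).toFinset : Finset _) :
      Set H.vertexSet) = e := by
    rw [Set.coe_toFinset, Subtype.image_preimage_coe]
    exact Set.inter_eq_right.2 (H.subset_vertexSet_of_mem_edgeSet he)
  exact ⟨_, mem_edgeFinset.2 (by rwa [h]), h⟩

lemma card_edgeFinset : #H.edgeFinset = H.numEdges := by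
  have h : H.edgeSet = (fun e : Finset H.vertexSet => Subtype.val '' (e : Set H.vertexSet)) ''
      (H.edgeFinset : Set (Finset H.vertexSet)) := by
    ext e
    constructor
    · intro he
      obtain ⟨e', h1, h2⟩ := exists_edgeFinset_of_mem he
      exact ⟨e', h1, h2⟩
    · rintro ⟨e', h1, rfl⟩
      exact mem_edgeFinset.1 h1
  rw [numEdges, h, Set.ncard_image_of_injective, Set.ncard_coe_finset]
  exact fun e e' hee => coe_injective (Subtype.val_injective.image_injective hee)

lemma card_vertexSet : Fintype.card H.vertexSet = H.numVerts := by
  rw [numVerts, Set.ncard_eq_toFinset_card', Set.toFinset_card]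

lemma IsUniform.card_eq {r : ℕ} (h : H.IsUniform r) {e : Finset H.vertexSet}
    (he : e ∈ H.edgeFinset) : #e = r := by
  have := h _ (mem_edgeFinset.1 he)
  rw [Set.InjOn.encard_image Subtype.val_injective.injOn, Set.encard_coe_eq_coe_finsetCard] at this
  exact_mod_cast this

lemma IsAut.image_edgeFinset [DecidableEq H.vertexSet] {σ : Equiv.Perm H.vertexSet}
    (hσ : H.IsAut σ) : (H.edgeFinset.image fun e => e.map σ.toEmbedding) = H.edgeFinset := by
  refine eq_of_subset_of_card_le ?_ ?_
  · intro e he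
    obtain ⟨e', he', rfl⟩ := mem_image.1 he
    rw [mem_edgeFinset, coe_map]
    exact (hσ e').2 (mem_edgeFinset.1 he')
  · rw [card_image_of_injective _ (Finset.map_injective _)]

lemma card_copies_mem_mul_minStab_le [DecidableEq H.vertexSet] {W : Type*} [Fintype W]
    [DecidableEq W] {r : ℕ} (h : H.IsUniform r) (R : Finset W) :
    #{A ∈ copies W H.edgeFinset | R ∈ A} * H.minStab ≤
      H.numEdges * (r.factorial * Fintype.card W ^ (H.numVerts - r)) := by
  classical
  rw [← card_edgeFinset, ← card_vertexSet]
  refine card_copies_mem_mul_le H.edgeFinset (fun e he => h.card_eq he)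
    (fun e => univ.filter fun σ => H.IsAut σ ∧ Subtype.val '' (σ '' (Subtype.val ⁻¹'
      (Subtype.val '' (e : Set H.vertexSet)))) = Subtype.val '' (e : Set H.vertexSet))
    ?_ ?_ ?_ R
  · intro e he
    rw [← Fintype.card_subtype, ← Nat.card_eq_fintype_card]
    exact Nat.sInf_le (Set.mem_image_of_mem _ (mem_edgeFinset.1 he))
  · intro e he σ hσ
    have h1 := (mem_filter.1 hσ).2.2
    rw [Set.preimage_image_eq _ Subtype.val_injective] at h1
    apply coe_injective
    rw [coe_map]
    exact Subtype.val_injective.image_injective h1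
  · intro e he σ hσ
    exact (mem_filter.1 hσ).2.1.image_edgeFinset

lemma minStab_pos (h : H.edgeSet.Nonempty) : 0 < H.minStab := by
  obtain ⟨e, he, hs⟩ := Nat.sInf_mem (h.image H.stabCount)
  rw [minStab, ← hs, stabCount, Nat.card_pos_iff]
  refine ⟨⟨⟨1, fun e => by simp, ?_⟩⟩, inferInstance⟩
  simp only [Equiv.Perm.coe_one, Set.image_id, Subtype.image_preimage_coe]
  exact Set.inter_eq_right.2 (H.subset_vertexSet_of_mem_edgeSet he)

end EdgeFinset

/-! ### From a transversal to a hypergraph of large chromatic number -/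

/-- The hypergraph on all of `β` with the given edges. -/
def ofFinset {β : Type*} (G : Finset (Finset β)) : Hypergraph β where
  vertexSet := Set.univ
  edgeSet := (fun e : Finset β => (e : Set β)) '' (G : Set (Finset β))
  subset_vertexSet_of_mem_edgeSet' := fun _ _ => Set.subset_univ _

lemma lt_chromaticNumber {α : Type*} {G : Hypergraph α} {k : ℕ}
    (h : ∀ j ≤ k, ¬ G.Colorable j) : (k : ℕ∞) < G.chromaticNumber := by
  have : ((k + 1 : ℕ) : ℕ∞) ≤ G.chromaticNumber := by
    refine le_iInf₂ fun j hj => ?_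
    rw [Nat.cast_le]
    by_contra! hlt
    exact h j (by omega) hj
  exact lt_of_lt_of_le (by exact_mod_cast Nat.lt_succ_self k) this

lemma not_colorable_ofFinset {n s k : ℕ} (hn : 0 < n) (hks : k * s ≤ n)
    {G : Finset (Finset (Fin n))}
    (hG : ∀ S : Finset (Fin n), #S = s → ∃ e ∈ G, e ⊆ S) : ¬ (ofFinset G).Colorable k := by
  rintro ⟨c, hc⟩
  let c' : Fin n → Fin k := fun v => c ⟨v, Set.mem_univ v⟩
  -- The colour of an actual vertex disposes of `k = 0`.
  have : Nonempty (Fin k) := ⟨c' ⟨0, hn⟩⟩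
  obtain ⟨a, ha⟩ := Fintype.exists_le_card_fiber_of_mul_le_card (n := s) c' (by simpa using hks)
  obtain ⟨S, hS, hSc⟩ := exists_subset_card_eq ha
  obtain ⟨e, he, heS⟩ := hG S hSc
  exact hc _ ⟨e, he, rfl⟩ ⟨a, fun v hv => (mem_filter.1 (hS (heS hv))).2⟩

/-- The deletion theorem with the `r`-sets as ground set, the copies of all `H i` as sets to avoid,
and the complete `r`-graphs on `s`-sets as sets to meet. -/
theorem exists_mem_edgeCounts_lt {ι : Type*} [Fintype ι] {α : ι → Type*} {r : ℕ}
    {H : ∀ i, Hypergraph (α i)} (hfin : ∀ i, (H i).vertexSet.Finite)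
    (hunif : ∀ i, (H i).IsUniform r) (hne : ∀ i, (H i).edgeSet.Nonempty)
    {n s k : ℕ} {p m : ℝ} (hn : 0 < n) (hks : k * s ≤ n) (hp0 : 0 ≤ p) (hp1 : p < 1) (hm : 0 < m)
    (h : n.choose s * ((1 - p) ^ s.choose r * Real.exp (s.choose r *
      ∑ i, (H i).numEdges * (r.factorial * (n : ℝ) ^ ((H i).numVerts - r)) / (H i).minStab *
        (p / (1 - p)) ^ (H i).numEdges)) + p * n.choose r / m < 1) :
    ∃ x ∈ edgeCounts r H k, (x : ℝ) < m := by
  classical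
  have := fun i => (hfin i).fintype
  have hq : 0 ≤ p / (1 - p) := div_nonneg hp0 (by linarith)
  let U : Finset (Finset (Fin n)) := powersetCard r univ
  let 𝒞 : Finset (Finset (Finset (Fin n))) :=
    univ.biUnion fun i => copies (Fin n) (H i).edgeFinset
  have hmem : ∀ {A}, A ∈ 𝒞 ↔ ∃ i, A ∈ copies (Fin n) (H i).edgeFinset := by
    intro A; simp [𝒞]
  have h𝒞 : ∀ A ∈ 𝒞, A ⊆ U := by
    intro A hA e he
    obtain ⟨i, hi⟩ := hmem.1 hA
    obtain ⟨f, -, rfl⟩ := mem_image.1 hi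
    obtain ⟨e, he', rfl⟩ := mem_image.1 he
    exact mem_powersetCard.2 ⟨subset_univ _, by rw [card_map, (hunif i).card_eq he']⟩
  have h𝒞ne : ∀ A ∈ 𝒞, A.Nonempty := by
    intro A hA
    obtain ⟨i, hi⟩ := hmem.1 hA
    obtain ⟨e, he⟩ := hne i
    obtain ⟨e', he', -⟩ := exists_edgeFinset_of_mem he
    rw [← card_pos, card_of_mem_copies hi]
    exact card_pos.2 ⟨e', he'⟩
  let ℬ : Finset (Finset (Finset (Fin n))) := (powersetCard s univ).image (powersetCard r)
  have hℬ : ∀ B ∈ ℬ, B ⊆ U := by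
    intro B hB
    obtain ⟨S, -, rfl⟩ := mem_image.1 hB
    exact powersetCard_mono (subset_univ _)
  -- A copy meeting `B` contains some `R ∈ B`, so the bound for a single edge is paid `#B` times.
  have hcopies : ∀ B : Finset (Finset (Fin n)), ∑ A ∈ 𝒞 with ¬ Disjoint A B, (p / (1 - p)) ^ #A
      ≤ #B * ∑ i, (H i).numEdges * (r.factorial * (n : ℝ) ^ ((H i).numVerts - r)) /
        (H i).minStab * (p / (1 - p)) ^ (H i).numEdges := by
    intro B
    calc _ ≤ ∑ A ∈ B.biUnion fun R => univ.biUnion fun i =>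
            (copies (Fin n) (H i).edgeFinset).filter fun A => R ∈ A, (p / (1 - p)) ^ #A := by
          refine sum_le_sum_of_subset_of_nonneg ?_ fun _ _ _ => pow_nonneg hq _
          intro A hA
          obtain ⟨hA, hAB⟩ := mem_filter.1 hA
          obtain ⟨R, hRA, hRB⟩ := not_disjoint_iff.1 hAB
          obtain ⟨i, hi⟩ := hmem.1 hA
          exact mem_biUnion.2 ⟨R, hRB, mem_biUnion.2 ⟨i, mem_univ i, mem_filter.2 ⟨hi, hRA⟩⟩⟩
      _ ≤ ∑ R ∈ B, ∑ i, ∑ A ∈ copies (Fin n) (H i).edgeFinset with R ∈ A,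
            (p / (1 - p)) ^ #A := by
          refine (RandomSubset.sum_biUnion_le _ _ fun _ => pow_nonneg hq _).trans ?_
          exact sum_le_sum fun R _ =>
            RandomSubset.sum_biUnion_le _ _ fun _ => pow_nonneg hq _
      _ ≤ ∑ R ∈ B, ∑ i, (H i).numEdges * (r.factorial * (n : ℝ) ^ ((H i).numVerts - r)) /
            (H i).minStab * (p / (1 - p)) ^ (H i).numEdges := by
          refine sum_le_sum fun R _ => sum_le_sum fun i _ => ?_
          have h1 : ∀ A ∈ (copies (Fin n) (H i).edgeFinset).filter fun A => R ∈ A,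
              (p / (1 - p)) ^ #A = (p / (1 - p)) ^ (H i).numEdges := by
            intro A hA
            rw [card_of_mem_copies (mem_filter.1 hA).1, card_edgeFinset]
          rw [sum_congr rfl h1, sum_const, nsmul_eq_mul]
          refine mul_le_mul_of_nonneg_right ?_ (pow_nonneg hq _)
          rw [le_div_iff₀ (by exact_mod_cast minStab_pos (hne i))]
          have := card_copies_mem_mul_minStab_le (hunif i) R
          rw [Fintype.card_fin] at this
          exact_mod_cast this
      _ = _ := by rw [sum_const, nsmul_eq_mul]
  obtain ⟨G, hGU, hfree, htrans, hcard⟩ := RandomSubset.exists_free_transversal U 𝒞 h𝒞 h𝒞ne ℬ hℬ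
    hp0 hp1 hm (by
      refine lt_of_le_of_lt (add_le_add ?_ ?_) h
      · calc _ ≤ ∑ B ∈ ℬ, ((1 - p) ^ s.choose r * Real.exp (s.choose r *
              ∑ i, (H i).numEdges * (r.factorial * (n : ℝ) ^ ((H i).numVerts - r)) /
                (H i).minStab * (p / (1 - p)) ^ (H i).numEdges)) := by
              refine sum_le_sum fun B hB => ?_
              have hBc : #B = s.choose r := by
                obtain ⟨S, hS, rfl⟩ := mem_image.1 hB
                rw [card_powersetCard, (mem_powersetCard.1 hS).2]
              have := hcopies B
              rw [hBc] at this ⊢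
              exact mul_le_mul_of_nonneg_left (Real.exp_le_exp.2 this)
                (pow_nonneg (by linarith) _)
          _ ≤ _ := by
              rw [sum_const, nsmul_eq_mul]
              refine mul_le_mul_of_nonneg_right ?_
                (mul_nonneg (pow_nonneg (by linarith) _) (Real.exp_pos _).le)
              have : #ℬ ≤ n.choose s := card_image_le.trans (by simp)
              exact_mod_cast this
      · simp [U])
  refine ⟨#G, ⟨n, ofFinset G, ?_, ?_, lt_chromaticNumber fun j hj => ?_, ?_⟩, hcard⟩
  · rintro _ ⟨e, he, rfl⟩
    rw [Set.encard_coe_eq_coe_finsetCard, (mem_powersetCard.1 (hGU he)).2]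
  · rintro i ⟨f, hf, -, hsub⟩
    let g : (H i).vertexSet ↪ Fin n := ⟨fun v => f v, fun v w hvw => Subtype.ext (hf v.2 w.2 hvw)⟩
    refine hfree _ (hmem.2 ⟨i, mem_image_of_mem _ (mem_univ g)⟩) fun e he => ?_
    obtain ⟨e', he', rfl⟩ := mem_image.1 he
    obtain ⟨A, hA, hAe⟩ := hsub (Set.mem_image_of_mem (Set.image f) (mem_edgeFinset.1 he'))
    have : A = e'.map g := by
      apply coe_injective
      rw [coe_map]
      refine hAe.trans ?_
      rw [Set.image_image]
      rfl
    exact this ▸ hA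
  · refine not_colorable_ofFinset hn ((Nat.mul_le_mul_right s hj).trans hks) fun S hS => ?_
    obtain ⟨e, he, heS⟩ := not_disjoint_iff.1 (htrans _ (mem_image_of_mem _
      (mem_powersetCard.2 ⟨subset_univ S, hS⟩)))
    exact ⟨e, he, (mem_powersetCard.1 heS).1⟩
  · rw [numEdges, ofFinset, Set.ncard_image_of_injective _ coe_injective, Set.ncard_coe_finset]

end Hypergraph

/-! ### The critical members and the constants -/

namespace Hypergraph

lemma finite_edgeSet {α : Type*} {H : Hypergraph α} (hfin : H.vertexSet.Finite) :
    H.edgeSet.Finite :=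
  hfin.finite_subsets.subset fun _ he => H.subset_vertexSet_of_mem_edgeSet he

lemma Nontrivial.two_le_numEdges {α : Type*} {H : Hypergraph α} (h : H.Nontrivial)
    (hfin : H.vertexSet.Finite) : 2 ≤ H.numEdges :=
  by
  have := (finite_edgeSet hfin).to_subtype
  exact Set.one_lt_ncard_iff_nontrivial.2 h

lemma Nontrivial.lt_numVerts {α : Type*} {H : Hypergraph α} {r : ℕ} (h : H.Nontrivial)
    (hfin : H.vertexSet.Finite) (hunif : H.IsUniform r) : r < H.numVerts := by
  by_contra! hle
  obtain ⟨e, he, e', he', hne⟩ := h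
  have key : ∀ f ∈ H.edgeSet, f = H.vertexSet := fun f hf => by
    refine Set.eq_of_subset_of_ncard_le (H.subset_vertexSet_of_mem_edgeSet hf) ?_ hfin
    have h1 : f.ncard = r := by rw [Set.ncard, hunif f hf, ENat.toNat_natCast]
    rw [h1]
    exact hle
  exact hne ((key e he).trans (key e' he').symm)

section Family

variable {ι : Type*} [Fintype ι] {α : ι → Type*} {r : ℕ} {H : ∀ i, Hypergraph (α i)}

lemma mem_critical {i : ι} : i ∈ critical r H ↔ (H i).rho r = familyRho r H := by
  simp [critical]

lemma critical_nonempty [Nonempty ι] : (critical r H).Nonempty := by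
  obtain ⟨i, hi⟩ := exists_eq_ciInf_of_finite (f := fun i => (H i).rho r)
  exact ⟨i, mem_critical.2 hi⟩

lemma familyRho_le (i : ι) : familyRho r H ≤ (H i).rho r :=
  ciInf_le (Set.finite_range _).bddBelow i

lemma criticalSum_term_le (x : ℝ) (hx : 0 ≤ x) {i : ι} (hi : i ∈ critical r H) :
    ((H i).numEdges : ℝ) * x ^ ((H i).numEdges - 1) / ((H i).minStab : ℝ) ≤ criticalSum r H x :=
  Finset.single_le_sum (f := fun i => ((H i).numEdges : ℝ) * x ^ ((H i).numEdges - 1) /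
    ((H i).minStab : ℝ)) (fun _ _ => by positivity) hi

lemma minStab_pos_of_nontrivial {α : Type*} {H : Hypergraph α} (hfin : H.vertexSet.Finite)
    (h : H.Nontrivial) : 0 < H.minStab := by
  have := hfin.fintype
  exact minStab_pos h.nonempty

/-- All exponents `e_i - 1` are at least `1` and all coefficients are positive, so the sum increases
strictly and continuously from `0`. -/
lemma exists_criticalSum_eq [Nonempty ι] (hfin : ∀ i, (H i).vertexSet.Finite)
    (hnontriv : ∀ i, (H i).Nontrivial) {t : ℝ} (ht0 : 0 < t) (ht1 : t ≤ 1) :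
    ∃ c : ℝ, 0 < c ∧ ∀ x : ℝ, 0 < x → (criticalSum r H x = t ↔ x = c) := by
  have hα : ∀ i, (0 : ℝ) < (H i).minStab := fun i => by
    exact_mod_cast minStab_pos_of_nontrivial (hfin i) (hnontriv i)
  have he : ∀ i, 2 ≤ (H i).numEdges := fun i => (hnontriv i).two_le_numEdges (hfin i)
  have hmono : StrictMonoOn (criticalSum r H) (Set.Ici 0) := by
    intro x hx y _ hxy
    refine Finset.sum_lt_sum_of_nonempty critical_nonempty fun i _ => ?_
    have h1 : x ^ ((H i).numEdges - 1) < y ^ ((H i).numEdges - 1) :=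
      pow_lt_pow_left₀ hxy hx (by have := he i; omega)
    have h2 : (0 : ℝ) < (H i).numEdges := by exact_mod_cast (by have := he i; omega)
    exact div_lt_div_of_pos_right (mul_lt_mul_of_pos_left h1 h2) (hα i)
  have hcont : Continuous (criticalSum r H) := by
    unfold criticalSum
    fun_prop
  have hzero : criticalSum r H 0 = 0 := by
    refine Finset.sum_eq_zero fun i _ => ?_
    rw [zero_pow (by have := he i; omega), mul_zero, zero_div]
  obtain ⟨i, hi⟩ := critical_nonempty (r := r) (H := H)
  -- At `x = α_i` the `i`-th term alone is `e_i α_i^(e_i - 2) ≥ 1`.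
  have hlarge : 1 ≤ criticalSum r H (H i).minStab := by
    refine le_trans ?_ (criticalSum_term_le _ (hα i).le hi)
    have h1 : (1 : ℝ) ≤ (H i).minStab := by
      exact_mod_cast minStab_pos_of_nontrivial (hfin i) (hnontriv i)
    have h2 : (1 : ℝ) ≤ (H i).numEdges := by exact_mod_cast (by have := he i; omega)
    have h3 : ((H i).minStab : ℝ) ≤ ((H i).minStab : ℝ) ^ ((H i).numEdges - 1) :=
      le_self_pow₀ h1 (by have := he i; omega)
    rw [le_div_iff₀ (hα i)]
    exact mul_le_mul h2 h3 (hα i).le (by linarith)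
  obtain ⟨c, hc, hct⟩ := intermediate_value_Icc (hα i).le hcont.continuousOn
    (show t ∈ Set.Icc _ _ by rw [hzero]; exact ⟨ht0.le, ht1.trans hlarge⟩)
  have hc0 : 0 < c := by
    refine lt_of_le_of_ne hc.1 fun h => ?_
    rw [← h, hzero] at hct
    exact ht0.ne hct
  refine ⟨c, hc0, fun x hx => ⟨fun h => ?_, fun h => h ▸ hct⟩⟩
  exact hmono.injOn hx.le hc0.le (h.trans hct.symm)

lemma exists_isGreatest_critical [Nonempty ι] (f : ι → ℝ) :
    ∃ i ∈ critical r H, IsGreatest {y : ℝ | ∃ i ∈ critical r H, y = f i} (f i) := by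
  obtain ⟨i, hi, hmax⟩ := Finset.exists_max_image (critical r H) f critical_nonempty
  exact ⟨i, hi, ⟨i, hi, rfl⟩, by rintro _ ⟨j, hj, rfl⟩; exact hmax j hj⟩

/-- A single term is at most the whole sum `1 / (50 r!)`, and `50 / 5 = 10`. -/
lemma ten_le_of_criticalSum_eq (hfin : ∀ i, (H i).vertexSet.Finite)
    (hnontriv : ∀ i, (H i).Nontrivial) {c : ℝ} (hc : 0 < c)
    (h : criticalSum r H c = 1 / (50 * (r.factorial : ℝ))) {i : ι} (hi : i ∈ critical r H) :
    10 ≤ ((H i).minStab : ℝ) /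
      (5 * ((H i).numEdges : ℝ) * c ^ ((H i).numEdges - 1) * (r.factorial : ℝ)) := by
  have hα : (0 : ℝ) < (H i).minStab := by
    exact_mod_cast minStab_pos_of_nontrivial (hfin i) (hnontriv i)
  have he : (0 : ℝ) < (H i).numEdges := by
    exact_mod_cast (by have := (hnontriv i).two_le_numEdges (hfin i); omega)
  have hr : (0 : ℝ) < r.factorial := by exact_mod_cast r.factorial_pos
  have h1 := criticalSum_term_le c hc.le hi
  rw [h, div_le_div_iff₀ hα (by positivity)] at h1
  rw [le_div_iff₀ (by positivity)]
  linarith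

/-- The expected number of copies through a fixed edge, divided by the edge probability, tends
to `r! * criticalSum`. -/
lemma tendsto_copies_through_edge (hfin : ∀ i, (H i).vertexSet.Finite)
    (hunif : ∀ i, (H i).IsUniform r) (hnontriv : ∀ i, (H i).Nontrivial)
    (hbal : ∀ i, (H i).IsBalanced r) (hρ : 0 < familyRho r H) (c : ℝ) :
    Tendsto (fun n : ℕ => ∑ i, (H i).numEdges *
        (r.factorial * (n : ℝ) ^ ((H i).numVerts - r)) / (H i).minStab *
        ((c * (n : ℝ) ^ (-(1 / familyRho r H))) ^ ((H i).numEdges - 1) /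
          (1 - c * (n : ℝ) ^ (-(1 / familyRho r H))) ^ (H i).numEdges))
      atTop (nhds (r.factorial * criticalSum r H c)) := by
  classical
  set a := 1 / familyRho r H with ha
  have ha0 : 0 < a := by positivity
  have hp : Tendsto (fun n : ℕ => c * (n : ℝ) ^ (-a)) atTop (nhds 0) := by
    have := ((tendsto_rpow_neg_atTop ha0).comp tendsto_natCast_atTop_atTop).const_mul c
    rwa [mul_zero] at this
  have hlim : r.factorial * criticalSum r H c = ∑ i, if i ∈ critical r H then
      r.factorial * (((H i).numEdges : ℝ) * c ^ ((H i).numEdges - 1) / ((H i).minStab : ℝ))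
      else 0 := by
    rw [criticalSum, Finset.mul_sum, Finset.sum_ite_mem, Finset.univ_inter]
  rw [hlim]
  refine tendsto_finsetSum _ fun i _ => ?_
  have hden : Tendsto (fun n : ℕ => (1 - c * (n : ℝ) ^ (-a)) ^ (H i).numEdges) atTop (nhds 1) := by
    have := (tendsto_const_nhds (x := (1 : ℝ)).sub hp).pow (H i).numEdges
    simpa using this
  -- The total exponent of `n`. By balancedness it is `(v_i - r)(1 - ρ_i / ρ)`: zero for critical
  -- `i`, negative otherwise.
  set b : ℝ := ((H i).numVerts - r) - a * ((H i).numEdges - 1) with hb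
  have hv : r < (H i).numVerts := (hnontriv i).lt_numVerts (hfin i) (hunif i)
  have he := (hnontriv i).two_le_numEdges (hfin i)
  have hv' : (0 : ℝ) < (H i).numVerts - r := sub_pos.2 (by exact_mod_cast hv)
  have he' : (0 : ℝ) < (H i).numEdges - 1 := sub_pos.2 (by exact_mod_cast (by omega))
  have hrho : (H i).rho r = ((H i).numEdges - 1) / ((H i).numVerts - r) := hbal i
  have hb' : b = (((H i).numVerts : ℝ) - r) * (1 - (H i).rho r / familyRho r H) := by
    rw [hb, ha, hrho]
    field_simp
  have hpow : Tendsto (fun n : ℕ => (n : ℝ) ^ b) atTop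
      (nhds (if i ∈ critical r H then 1 else 0)) := by
    split_ifs with hi
    · have : b = 0 := by rw [hb', mem_critical.1 hi, div_self hρ.ne', sub_self, mul_zero]
      simp [this]
    · have hlt : familyRho r H < (H i).rho r :=
        lt_of_le_of_ne (familyRho_le i) fun h => hi (mem_critical.2 h.symm)
      have hneg : b < 0 := by
        rw [hb']
        refine mul_neg_of_pos_of_neg hv' (sub_neg.2 ?_)
        rwa [one_lt_div hρ]
      have := (tendsto_rpow_neg_atTop (neg_pos.2 hneg)).comp 
        (tendsto_natCast_atTop_atTop (R := ℝ))
      simpa [Function.comp_def] using this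
  have hmain := ((hpow.const_mul (r.factorial * (((H i).numEdges : ℝ) *
    c ^ ((H i).numEdges - 1) / ((H i).minStab : ℝ)))).div hden one_ne_zero)
  have hval : r.factorial * (((H i).numEdges : ℝ) * c ^ ((H i).numEdges - 1) /
      ((H i).minStab : ℝ)) * (if i ∈ critical r H then (1 : ℝ) else 0) / 1 =
      if i ∈ critical r H then r.factorial * (((H i).numEdges : ℝ) * c ^ ((H i).numEdges - 1) /
        ((H i).minStab : ℝ)) else 0 := by
    split_ifs <;> simp
  rw [hval] at hmain
  refine hmain.congr' ?_
  filter_upwards [eventually_gt_atTop 0] with n hn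
  have hn' : (0 : ℝ) < n := by exact_mod_cast hn
  have hnb : (n : ℝ) ^ b = (n : ℝ) ^ ((H i).numVerts - r) * ((n : ℝ) ^ (-a)) ^ ((H i).numEdges - 1)
      := by
    rw [← Real.rpow_natCast, ← Real.rpow_natCast, ← Real.rpow_mul hn'.le, ← Real.rpow_add hn',
      Nat.cast_sub hv.le, Nat.cast_sub (by omega), hb]
    congr 1
    push_cast
    ring
  simp only [Pi.div_apply]
  rw [hnb, mul_pow]
  ring

end Family

end Hypergraph

/-! ### Choice of the numbers `n` and `s` -/

namespace Hypergraph

/-- Each factor of the falling factorial is at least `s + 1 - r ≥ y (1 - 1/(2r))`, and Bernoulli's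
inequality bounds the `r`-th power of the last factor below by `1/2`. -/
lemma half_pow_le_choose {r s : ℕ} (hr : 1 ≤ r) {y : ℝ} (hy : 2 * r * (r + 1) ≤ y)
    (hs : y - 1 ≤ s + 1) : y ^ r / (2 * r.factorial) ≤ s.choose r := by
  have hr' : (1 : ℝ) ≤ r := by exact_mod_cast hr
  have hfac : (0 : ℝ) < r.factorial := by exact_mod_cast r.factorial_pos
  have hy0 : 0 ≤ y := by nlinarith
  have h1 : ((s + 1 - r : ℕ) : ℝ) ^ r ≤ r.factorial * s.choose r := by
    have := Nat.pow_sub_le_descFactorial s r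
    rw [Nat.descFactorial_eq_factorial_mul_choose] at this
    exact_mod_cast this
  have h2 : y * (1 - 1 / (2 * r)) ≤ ((s + 1 - r : ℕ) : ℝ) := by
    have h3 : ((s : ℝ) + 1) - r ≤ ((s + 1 - r : ℕ) : ℝ) := by
      have : ((s + 1 : ℕ) : ℝ) ≤ ((s + 1 - r + r : ℕ) : ℝ) := by
        exact_mod_cast (by omega)
      push_cast at this
      linarith
    have h4 : (r : ℝ) + 1 ≤ y * (1 / (2 * r)) := by
      rw [mul_one_div, le_div_iff₀ (by positivity)]
      linarith
    linarith
  have h5 : (1 : ℝ) / 2 ≤ (1 - 1 / (2 * r)) ^ r := by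
    have h6 : (1 : ℝ) / (2 * r) ≤ 1 := by
      rw [div_le_one (by positivity)]
      linarith
    have := one_add_mul_le_pow (a := -(1 / (2 * r : ℝ))) (by linarith) r
    have h7 : 1 + (r : ℝ) * -(1 / (2 * r)) = 1 / 2 := by field_simp; norm_num
    rw [h7] at this
    simpa [sub_eq_add_neg] using this
  have h8 : (0 : ℝ) ≤ 1 - 1 / (2 * r) := by
    rw [sub_nonneg, div_le_one (by positivity)]
    linarith
  have h9 : y ^ r * (1 / 2) ≤ r.factorial * s.choose r := by
    calc y ^ r * (1 / 2) ≤ y ^ r * (1 - 1 / (2 * r)) ^ r :=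
          mul_le_mul_of_nonneg_left h5 (pow_nonneg hy0 _)
      _ = (y * (1 - 1 / (2 * r))) ^ r := (mul_pow _ _ _).symm
      _ ≤ _ := pow_le_pow_left₀ (mul_nonneg hy0 h8) h2 r
      _ ≤ _ := h1
  rw [div_le_iff₀ (by positivity)]
  linarith

lemma eventually_const_add_log_le (K : ℝ) {ε : ℝ} (hε : 0 < ε) :
    ∀ᶠ L : ℝ in atTop, K + Real.log L ≤ ε * L := by
  have h1 := (Real.isLittleO_log_id_atTop.bound (half_pos hε))
  filter_upwards [h1, eventually_ge_atTop (2 * K / ε), eventually_ge_atTop 0] with L hL hK h0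
  rw [id, Real.norm_eq_abs, Real.norm_eq_abs, abs_of_nonneg h0] at hL
  have := le_abs_self (Real.log L)
  rw [div_le_iff₀ hε] at hK
  linarith

/-- The number of vertices used for the random hypergraph, before rounding, is
`(K * k ^ (r - 1) * log k) ^ (1 / γ)`. -/
lemma tendsto_size_div_atTop {r : ℕ} {γ K : ℝ} (hγ : 0 < γ) (hγr : γ < r - 1) (hr : 2 ≤ r)
    (hK : 0 < K) :
    Tendsto (fun k : ℕ => (K * ((k : ℝ) ^ (r - 1) * Real.log k)) ^ (1 / γ) / k) atTop atTop := by
  have hδ : 0 < ((r : ℝ) - 1) / γ - 1 := by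
    rw [sub_pos, one_lt_div hγ]
    exact hγr
  -- Once `K log k ≥ 1`, the quotient is at least `k^((r-1)/γ - 1)`, whose exponent is positive.
  refine tendsto_atTop_mono' _ ?_ ((tendsto_rpow_atTop hδ).comp tendsto_natCast_atTop_atTop)
  have hlog : Tendsto (fun k : ℕ => Real.log k) atTop atTop :=
    Real.tendsto_log_atTop.comp tendsto_natCast_atTop_atTop
  filter_upwards [eventually_gt_atTop 0, hlog.eventually_ge_atTop (1 / K)] with k hk hL
  have hk' : (0 : ℝ) < k := by exact_mod_cast hk
  rw [div_le_iff₀ hK] at hL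
  simp only [Function.comp]
  rw [Real.rpow_sub_one hk'.ne']
  refine div_le_div_of_nonneg_right ?_ hk'.le
  have h1 : (k : ℝ) ^ (((r : ℝ) - 1) / γ) = ((k : ℝ) ^ (r - 1)) ^ (1 / γ) := by
    rw [← Real.rpow_natCast, ← Real.rpow_mul hk'.le, Nat.cast_sub (by omega)]
    congr 1
    push_cast
    ring
  rw [h1]
  refine Real.rpow_le_rpow (by positivity) ?_ (by positivity)
  have : 0 < (k : ℝ) ^ (r - 1) := by positivity
  nlinarith

theorem eventually_exists_parameters {r : ℕ} (hr : 2 ≤ r) {ρ c₁ c₂ : ℝ}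
    (hρ : 1 / ((r : ℝ) - 1) < ρ) (hc₁ : 0 < c₁) (hc₂ : 0 < c₂) (hB : 10 ≤ c₂ ^ ((r : ℝ) - 1))
    (N₀ : ℕ) :
    ∀ᶠ k : ℕ in atTop, ∃ n s : ℕ, N₀ ≤ n ∧ k * s ≤ n ∧ 2 ≤ s * Real.log n ∧
      2 * (s * Real.log n) ≤ c₁ * (n : ℝ) ^ (-(1 / ρ)) * s.choose r ∧
      2 * (c₁ * (n : ℝ) ^ (-(1 / ρ)) * ((n : ℝ) ^ r / r.factorial)) ≤ edgeBound 1 r ρ c₁ c₂ k := by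
  have hr1 : (0 : ℝ) < r - 1 := by
    have : (2 : ℝ) ≤ r := by exact_mod_cast hr
    linarith
  have hρ0 : 0 < ρ := lt_trans (by positivity) hρ
  unfold edgeBound
  set a := 1 / ρ with ha
  have ha0 : 0 < a := by positivity
  have har : a < r - 1 := by
    rw [ha, one_div_lt hρ0 hr1]
    exact hρ
  clear_value a
  set γ := (r : ℝ) - 1 - a with hγ
  have hγ0 : 0 < γ := by rw [hγ]; linarith
  set B := c₂ ^ ((r : ℝ) - 1) with hBdef
  have hB0 : 0 < B := by linarith
  set f := (r.factorial : ℝ) with hf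
  have hf0 : 0 < f := by rw [hf]; exact_mod_cast r.factorial_pos
  set g := ((r : ℝ) - 1) / γ with hg
  have hg0 : 0 < g := by positivity
  -- With `x^γ = K k^(r-1) log k` and `y = x / k` one gets `x^(-a) y^r = K y log k`, while `log x`
  -- is about `g log k`. So `K` must be of order `f g / c₁`; the factor `1/2` pays for the `2` in
  -- the edge count.
  set K := 1 / 2 * (f / c₁ * B * g) with hK
  have hK0 : 0 < K := by positivity
  clear_value K g f B γ
  have hlog : Tendsto (fun k : ℕ => Real.log k) atTop atTop :=
    Real.tendsto_log_atTop.comp tendsto_natCast_atTop_atTop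
  filter_upwards [eventually_ge_atTop 1, hlog.eventually_ge_atTop 1,
    (tendsto_size_div_atTop hγ0 (by rw [hγ]; linarith) hr hK0).eventually_ge_atTop
      (max (2 * r * (r + 1)) (max (N₀ + 1) (Real.exp 2 + 1))),
    hlog.eventually (eventually_const_add_log_le (Real.log K)
      (ε := ((r : ℝ) - 1) / 4) (by positivity))] with k hk hL hy hlogx
  have hk' : (1 : ℝ) ≤ k := by exact_mod_cast hk
  have hk0 : (0 : ℝ) < k := by linarith
  set L := Real.log k with hLdef
  set Q := (k : ℝ) ^ (r - 1) * L with hQ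
  have hQ0 : 0 < Q := by positivity
  set x := (K * Q) ^ (1 / γ) with hx
  have hx0 : 0 < x := by positivity
  set y := x / k with hydef
  clear_value y x Q L
  have hxy : x = y * k := by rw [hydef]; field_simp
  have hy1 := (le_max_left _ _).trans hy
  have hy2 := ((le_max_left _ _).trans (le_max_right _ _)).trans hy
  have hy3 := ((le_max_right _ _).trans (le_max_right _ _)).trans hy
  have hy0 : 0 < y := hydef ▸ div_pos hx0 hk0
  have hyx : y ≤ x := hxy ▸ le_mul_of_one_le_right hy0.le hk'
  set n := ⌊x⌋₊ with hn
  have hnx : (n : ℝ) ≤ x := Nat.floor_le hx0.le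
  have hxn : x < n + 1 := Nat.lt_floor_add_one x
  have hnexp : Real.exp 2 ≤ n := by linarith
  have hn0 : (0 : ℝ) < n := (Real.exp_pos 2).trans_le hnexp
  have hlogn : 2 ≤ Real.log n := (Real.le_log_iff_exp_le hn0).2 hnexp
  set s := n / k with hs
  have hksn : k * s ≤ n := Nat.mul_div_le n k
  have hsy : (s : ℝ) ≤ y := by
    rw [hydef, le_div_iff₀ hk0]
    have : ((k * s : ℕ) : ℝ) ≤ n := by exact_mod_cast hksn
    push_cast at this
    linarith
  -- Both roundings together are harmless: `x < n + 1 ≤ k (s + 1)`.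
  have hys : y - 1 ≤ s + 1 := by
    have h1 : n + 1 ≤ k * (s + 1) := by
      have := Nat.lt_mul_div_succ n (show 0 < k by omega)
      exact this
    have h2 : (n : ℝ) + 1 ≤ k * (s + 1) := by exact_mod_cast h1
    have h3 : y * k ≤ (s + 1) * k := by linarith
    have := le_of_mul_le_mul_right h3 hk0
    linarith
  have hr2 : (2 : ℝ) ≤ r := by exact_mod_cast hr
  have hs1 : (1 : ℝ) ≤ s := by
    have : (2 : ℝ) * 2 * (2 + 1) ≤ 2 * r * (r + 1) := by gcongr
    linarith
  clear_value s n
  refine ⟨n, s, ?_, hksn, ?_, ?_, ?_⟩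
  · have : (N₀ : ℝ) ≤ n := by linarith
    exact_mod_cast this
  · calc (2 : ℝ) = 1 * 2 := (one_mul 2).symm
      _ ≤ s * Real.log n := mul_le_mul hs1 hlogn zero_le_two (by linarith)
  · have hxγ : x ^ γ = K * Q := by
      rw [hx, ← Real.rpow_mul (by positivity), one_div, inv_mul_cancel₀ hγ0.ne', Real.rpow_one]
    have hlx : Real.log x ≤ 5 / 4 * g * L := by
      have h1 : Real.log x = 1 / γ * (Real.log K + ((r - 1) * L + Real.log L)) := by
        rw [hx, Real.log_rpow (by positivity), Real.log_mul hK0.ne' hQ0.ne', hQ,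
          Real.log_mul (by positivity) (by linarith), Real.log_pow, Nat.cast_sub (by omega), ← hLdef]
        push_cast
        ring
      have h2 : 5 / 4 * g * L = 1 / γ * (((r : ℝ) - 1) / 4 * L + (r - 1) * L) := by
        rw [hg]; ring
      rw [h1, h2]
      refine mul_le_mul_of_nonneg_left ?_ (by positivity)
      linarith
    have hxa : x ^ (-a) * y ^ r = K * L * y := by
      have h1 : x ^ (-a) * x ^ (r - 1) = K * Q := by
        rw [← hxγ, ← Real.rpow_natCast, ← Real.rpow_add hx0, Nat.cast_sub (by omega), hγ]
        congr 1
        push_cast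
        ring
      have h2 : x ^ (r - 1) = y ^ (r - 1) * (k : ℝ) ^ (r - 1) := by rw [hxy, mul_pow]
      have h3 : x ^ (-a) * y ^ (r - 1) = K * L := by
        have : 0 < (k : ℝ) ^ (r - 1) := by positivity
        apply mul_right_cancel₀ this.ne'
        rw [mul_assoc, ← h2, h1, hQ]
        ring
      rw [← h3, mul_assoc, ← pow_succ, Nat.sub_add_cancel (by omega)]
    calc 2 * (s * Real.log n) ≤ 2 * (y * Real.log x) := by
          have := Real.log_le_log hn0 hnx
          have : s * Real.log n ≤ y * Real.log x :=
            mul_le_mul hsy this (by linarith) hy0.le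
          linarith
      _ ≤ 2 * (y * (5 / 4 * g * L)) := by
          have := mul_le_mul_of_nonneg_left hlx hy0.le
          linarith
      _ ≤ c₁ * (K * L * y) / (2 * f) := by
          -- Here `B ≥ 10` is exactly what is needed: `10 / 4 = 2 * (5 / 4)`.
          have h1 : c₁ * (K * L * y) / (2 * f) = B / 4 * (g * L * y) := by
            rw [hK]; field_simp; norm_num
          rw [h1]
          have h2 : 0 < g * L * y := by positivity
          have h3 := mul_le_mul_of_nonneg_right hB h2.le
          linarith
      _ = c₁ * x ^ (-a) * (y ^ r / (2 * f)) := by rw [← hxa]; ring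
      _ ≤ c₁ * (n : ℝ) ^ (-a) * s.choose r := by
          refine mul_le_mul (mul_le_mul_of_nonneg_left ?_ hc₁.le)
            (hf ▸ half_pow_le_choose (by omega) hy1 hys) (by positivity) (by positivity)
          exact Real.rpow_le_rpow_of_nonpos hn0 hnx (by linarith)
  · set E := ((r : ℝ) - a) / γ with hE
    have hE1 : E = 1 + 1 / γ := by
      rw [hE, show (r : ℝ) - a = γ + 1 by rw [hγ]; ring, add_div, div_self hγ0.ne']
    have hra : 0 ≤ (r : ℝ) - a := by linarith
    have h1 : (n : ℝ) ^ (-a) * (n : ℝ) ^ r = (n : ℝ) ^ ((r : ℝ) - a) := by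
      rw [← Real.rpow_natCast, ← Real.rpow_add hn0]
      congr 1
      ring
    have h2 : x ^ ((r : ℝ) - a) = (1 / 2) ^ E * (f / c₁) ^ E * B ^ E * g ^ E * Q ^ E := by
      rw [hx, ← Real.rpow_mul (by positivity), show 1 / γ * ((r : ℝ) - a) = E by rw [hE]; ring, hK,
        Real.mul_rpow (by positivity) hQ0.le, Real.mul_rpow (by positivity) (by positivity),
        Real.mul_rpow (by positivity) hg0.le, Real.mul_rpow (by positivity) hB0.le]
      ring
    have h3 : (f / c₁) ^ E = f / c₁ * (f / c₁) ^ (1 / γ) := by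
      rw [hE1, Real.rpow_add (by positivity), Real.rpow_one]
    have h4 : c₂ ^ (((r : ℝ) - 1) * ((r : ℝ) - a) / γ) = B ^ E := by
      rw [hBdef, ← Real.rpow_mul hc₂.le, hE]
      congr 1
      ring
    -- Since `E > 1`, the `1/2` in `K` absorbs the factor `2`, leaving constant `1`.
    have h5 : ((1 : ℝ) / 2) ^ E ≤ 1 / 2 := by
      have := Real.rpow_le_rpow_of_exponent_ge (x := 1 / 2) (by norm_num) (by norm_num)
        (show 1 ≤ E by rw [hE1]; have : 0 < 1 / γ := by positivity
                       linarith)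
      rwa [Real.rpow_one] at this
    rw [h4]
    calc 2 * (c₁ * (n : ℝ) ^ (-a) * ((n : ℝ) ^ r / f))
        = 2 * (c₁ / f) * (n : ℝ) ^ ((r : ℝ) - a) := by rw [← h1]; ring
      _ ≤ 2 * (c₁ / f) * x ^ ((r : ℝ) - a) :=
          mul_le_mul_of_nonneg_left (Real.rpow_le_rpow hn0.le hnx hra) (by positivity)
      _ = 2 * (1 / 2) ^ E * ((f / c₁) ^ (1 / γ) * B ^ E * g ^ E * Q ^ E) := by
          rw [h2, h3]
          field_simp
      _ ≤ 1 * ((f / c₁) ^ (1 / γ) * B ^ E * g ^ E * Q ^ E) :=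
          mul_le_mul_of_nonneg_right (by linarith) (by positivity)
      _ = _ := by ring

end Hypergraph

/-! ### Assembling the bound -/

namespace Hypergraph

theorem eventually_exists_mem_edgeCounts_lt {ι : Type*} [Fintype ι] {α : ι → Type*} {r : ℕ}
    (hr : 2 ≤ r) {H : ∀ i, Hypergraph (α i)} (hfin : ∀ i, (H i).vertexSet.Finite)
    (hunif : ∀ i, (H i).IsUniform r) (hnontriv : ∀ i, (H i).Nontrivial)
    (hbal : ∀ i, (H i).IsBalanced r) (hrho : 1 / ((r : ℝ) - 1) < familyRho r H)
    {c₁ c₂ : ℝ} (hc₁ : 0 < c₁) (hsum : criticalSum r H c₁ = 1 / (50 * (r.factorial : ℝ)))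
    (hc₂ : 0 < c₂) (hB : 10 ≤ c₂ ^ ((r : ℝ) - 1)) :
    ∀ᶠ k : ℕ in atTop, ∃ x ∈ edgeCounts r H k, (x : ℝ) < edgeBound 1 r (familyRho r H) c₁ c₂ k := by
  have hr1 : (0 : ℝ) < r - 1 := by
    have : (2 : ℝ) ≤ r := by exact_mod_cast hr
    linarith
  have hρ0 : 0 < familyRho r H := lt_trans (by positivity) hrho
  have hf0 : (0 : ℝ) < r.factorial := by exact_mod_cast r.factorial_pos
  have hcopies := tendsto_copies_through_edge hfin hunif hnontriv hbal hρ0 c₁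
  -- The limit is `1/50`, strictly below the `1/10` needed for large `n`.
  have hval : r.factorial * criticalSum r H c₁ < 1 / 10 := by
    rw [hsum, mul_one_div, div_lt_div_iff₀ (by positivity) (by norm_num)]
    linarith
  have hp : Tendsto (fun n : ℕ => c₁ * (n : ℝ) ^ (-(1 / familyRho r H))) atTop (nhds 0) := by
    have := ((tendsto_rpow_neg_atTop (one_div_pos.2 hρ0)).comp
      (tendsto_natCast_atTop_atTop (R := ℝ))).const_mul c₁
    rwa [mul_zero] at this
  obtain ⟨N₀, hN₀⟩ := eventually_atTop.1 ((hcopies.eventually_lt_const hval).and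
    ((hp.eventually_lt_const one_pos).and (eventually_gt_atTop 0)))
  filter_upwards [eventually_exists_parameters hr hrho hc₁ hc₂ hB N₀] with k hk
  obtain ⟨n, s, hn, hks, hs2, hM, hbound⟩ := hk
  obtain ⟨hT, hp1, hn0⟩ := hN₀ n hn
  have hn0' : (0 : ℝ) < n := by exact_mod_cast hn0
  set p := c₁ * (n : ℝ) ^ (-(1 / familyRho r H)) with hpdef
  have hp0 : 0 < p := by positivity
  have hq : 0 < 1 - p := by linarith
  have hm0 : 0 < 2 * (p * ((n : ℝ) ^ r / r.factorial)) := by positivity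
  refine (exists_mem_edgeCounts_lt (H := H) hfin hunif (fun i => (hnontriv i).nonempty) hn0 hks
    hp0.le hp1 hm0 ?_).imp fun x hx => ⟨hx.1, hx.2.trans_le hbound⟩
  have hsecond : p * n.choose r / (2 * (p * ((n : ℝ) ^ r / r.factorial))) ≤ 1 / 2 := by
    rw [div_le_iff₀ hm0]
    have := mul_le_mul_of_nonneg_left (Nat.choose_le_pow_div (α := ℝ) r n) hp0.le
    linarith
  have hsumT : ∑ i, (H i).numEdges * (r.factorial * (n : ℝ) ^ ((H i).numVerts - r)) /
      (H i).minStab * (p / (1 - p)) ^ (H i).numEdges ≤ p / 10 := by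
    have h1 : ∑ i, (H i).numEdges * (r.factorial * (n : ℝ) ^ ((H i).numVerts - r)) /
        (H i).minStab * (p / (1 - p)) ^ (H i).numEdges =
        p * ∑ i, (H i).numEdges * (r.factorial * (n : ℝ) ^ ((H i).numVerts - r)) /
          (H i).minStab * (p ^ ((H i).numEdges - 1) / (1 - p) ^ (H i).numEdges) := by
      rw [Finset.mul_sum]
      refine Finset.sum_congr rfl fun i _ => ?_
      have h2 : p ^ (H i).numEdges = p * p ^ ((H i).numEdges - 1) := by
        rw [← pow_succ', Nat.sub_add_cancel]
        have := (hnontriv i).two_le_numEdges (hfin i)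
        omega
      rw [div_pow, h2]
      ring
    rw [h1]
    have := mul_le_mul_of_nonneg_left hT.le hp0.le
    linarith
  have hfirst : n.choose s * ((1 - p) ^ s.choose r * Real.exp (s.choose r *
      ∑ i, (H i).numEdges * (r.factorial * (n : ℝ) ^ ((H i).numVerts - r)) / (H i).minStab *
        (p / (1 - p)) ^ (H i).numEdges)) < 1 / 2 := by
    have h1 : (n.choose s : ℝ) ≤ Real.exp (s * Real.log n) := by
      rw [mul_comm, Real.exp_mul, Real.exp_log hn0', Real.rpow_natCast]
      exact_mod_cast Nat.choose_le_pow n s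
    have h2 : (1 - p) ^ s.choose r ≤ Real.exp (-(p * s.choose r)) := by
      have := pow_le_pow_left₀ hq.le (Real.one_sub_le_exp_neg p) (s.choose r)
      rwa [← Real.exp_nat_mul, mul_neg, mul_comm] at this
    have h3 : Real.exp (s.choose r *
      ∑ i, (H i).numEdges * (r.factorial * (n : ℝ) ^ ((H i).numVerts - r)) / (H i).minStab *
        (p / (1 - p)) ^ (H i).numEdges) ≤ Real.exp (s.choose r * (p / 10)) :=
      Real.exp_le_exp.2 (mul_le_mul_of_nonneg_left hsumT (Nat.cast_nonneg _))
    -- From `p N ≥ 2 s log n` and `s log n ≥ 2`, the exponent is at most `(1 - 1.8) s log n ≤ -1.6`.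
    have h4 : (s : ℝ) * Real.log n + (-(p * s.choose r) + s.choose r * (p / 10)) ≤ -(8 / 5) := by
      linarith
    have h5 : Real.exp (-(8 / 5)) < 1 / 2 := by
      rw [Real.exp_neg, ← one_div, one_div_lt_one_div (Real.exp_pos _) (by norm_num)]
      have := Real.add_one_le_exp (8 / 5 : ℝ)
      linarith
    refine lt_of_le_of_lt ?_ h5
    refine (mul_le_mul h1 (mul_le_mul h2 h3 (Real.exp_pos _).le (Real.exp_pos _).le)
      (mul_nonneg (pow_nonneg hq.le _) (Real.exp_pos _).le) (Real.exp_pos _).le).trans ?_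
    rw [← Real.exp_add, ← Real.exp_add]
    exact Real.exp_le_exp.2 h4
  linarith

lemma edgeBound_eq_mul (C : ℝ) (r : ℕ) (ρ c₁ c₂ : ℝ) (k : ℕ) :
    edgeBound C r ρ c₁ c₂ k = C * edgeBound 1 r ρ c₁ c₂ k := by
  unfold edgeBound
  ring

lemma minEdges_lt_of_mem {ι : Type*} {α : ι → Type*} {r : ℕ} {H : ∀ i, Hypergraph (α i)}
    {k : ℕ} {C ρ c₁ c₂ : ℝ} (hC : 1 ≤ C)
    (h : ∃ x ∈ edgeCounts r H k, (x : ℝ) < edgeBound 1 r ρ c₁ c₂ k) :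
    (minEdges r H k : ℝ) < edgeBound C r ρ c₁ c₂ k := by
  obtain ⟨x, hx, hlt⟩ := h
  have h1 : (minEdges r H k : ℝ) ≤ x := by exact_mod_cast Nat.sInf_le hx
  have h2 : (0 : ℝ) ≤ x := Nat.cast_nonneg x
  rw [edgeBound_eq_mul]
  nlinarith

end Hypergraph

theorem theorem2 {ι : Type*} [Fintype ι] [Nonempty ι] {α : ι → Type*} (r : ℕ) (hr : 2 ≤ r)
    (H : ∀ i, Hypergraph (α i))
    (hfin : ∀ i, (H i).vertexSet.Finite)
    (hunif : ∀ i, (H i).IsUniform r)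
    (hnontriv : ∀ i, (H i).Nontrivial)
    (hbal : ∀ i, (H i).IsBalanced r)
    (hrho : 1 / ((r : ℝ) - 1) < Hypergraph.familyRho r H) :
    ∃ c₁ : ℝ, 0 < c₁ ∧
      (∀ x : ℝ, 0 < x →
        (Hypergraph.criticalSum r H x = 1 / (50 * (r.factorial : ℝ)) ↔ x = c₁)) ∧
      ∃ c₂ : ℝ,
        IsGreatest {y : ℝ | ∃ i ∈ Hypergraph.critical r H,
          y = (((H i).minStab : ℝ) /
            (5 * ((H i).numEdges : ℝ) * c₁ ^ ((H i).numEdges - 1) * (r.factorial : ℝ))) ^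
              (1 / ((r : ℝ) - 1))} c₂ ∧
        (10 : ℝ) ^ (1 / ((r : ℝ) - 1)) ≤ c₂ ∧
        (∀ᶠ k : ℕ in atTop, (Hypergraph.edgeCounts r H k).Nonempty ∧
          (Hypergraph.minEdges r H k : ℝ) <
            Hypergraph.edgeBound 2 r (Hypergraph.familyRho r H) c₁ c₂ k) ∧
        (∀ C : ℝ, 1 < C → ∀ᶠ k : ℕ in atTop,
          (Hypergraph.minEdges r H k : ℝ) <
            Hypergraph.edgeBound C r (Hypergraph.familyRho r H) c₁ c₂ k) := by
  have hr1 : (0 : ℝ) < r - 1 := by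
    have : (2 : ℝ) ≤ r := by exact_mod_cast hr
    linarith
  have hf1 : (1 : ℝ) ≤ r.factorial := by exact_mod_cast r.factorial_pos
  obtain ⟨c₁, hc₁, huniq⟩ := Hypergraph.exists_criticalSum_eq (r := r) (H := H) hfin hnontriv
    (t := 1 / (50 * (r.factorial : ℝ))) (by positivity)
    (by rw [div_le_one (by positivity)]; linarith)
  have hsum := (huniq c₁ hc₁).2 rfl
  refine ⟨c₁, hc₁, huniq, ?_⟩
  obtain ⟨i, hi, hgreatest⟩ := Hypergraph.exists_isGreatest_critical (r := r) (H := H)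
    fun i => (((H i).minStab : ℝ) /
      (5 * ((H i).numEdges : ℝ) * c₁ ^ ((H i).numEdges - 1) * (r.factorial : ℝ))) ^
        (1 / ((r : ℝ) - 1))
  refine ⟨_, hgreatest, ?_, ?_⟩
  all_goals
    have hten := Hypergraph.ten_le_of_criticalSum_eq hfin hnontriv hc₁ hsum hi
  · exact Real.rpow_le_rpow (by norm_num) hten (by positivity)
  -- The asymptotic argument needs of `c₂` only that it is positive and `c₂^(r-1) ≥ 10`.
  have hev := Hypergraph.eventually_exists_mem_edgeCounts_lt hr hfin hunif hnontriv hbal hrho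
    hc₁ hsum (Real.rpow_pos_of_pos (by linarith) (1 / ((r : ℝ) - 1)))
    (by rwa [← Real.rpow_mul (by linarith), one_div_mul_cancel hr1.ne', Real.rpow_one])
  refine ⟨?_, fun C hC => ?_⟩
  · filter_upwards [hev] with k hk
    refine ⟨?_, Hypergraph.minEdges_lt_of_mem (by norm_num) hk⟩
    obtain ⟨x, hx, -⟩ := hk
    exact ⟨x, hx⟩
  · filter_upwards [hev] with k hk
    exact Hypergraph.minEdges_lt_of_mem hC.le hk
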